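/- Let $\Omega$, $M$, $A$ be finite sets with $|M|\ge\min\{|\Omega|,|A|\}$, let $u_S,u_R:\Omega\times A\to\mathbb R$, and let $Q(\omega'\mid\omega)$ be the transition matrix of an irreducible, aperiodic Markov chain on $\Omega$ that is pseudo-renewal: there are $\beta_\omega\ge 0$ with $\sum_\omega\beta_\omega\le 1$ and $Q(\omega\mid\tilde\omega)=\beta_\omega$ whenever $\omega\ne\tilde\omega$. Let $\mu\in\Delta(\Omega)$ be its invariant distribution. Consider the following dynamic game. The state $\omega_1$ is drawn from $\mu$, and $(\omega_n)$ follows the chain. In each period $n\ge 1$ the sender observes $\omega_n$ and sends a message $m_n\in M$, and the receiver then chooses $a_n\in A$, which the sender does not observe. A strategy of the sender is a sequence $\sigma_n:(\Omega\times M)^{n-1}\times\Omega\to\Delta(M)$, and a strategy of the receiver is a sequence $\tau_n:(M\times A)^{n-1}\times M\to\Delta(A)$. For $\delta\in(0,1)$ and $i\in\{S,R\}$ put $\gamma_i^\delta(\sigma,\tau)=\mathbb E_{\sigma,\tau}\big[(1-\delta)\sum_{n\ge1}\delta^{n-1}u_i(\omega_n,a_n)\big]$. A vector $e=(e_S,e_R)\in\mathbb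 R^2$ is a uniform equilibrium payoff if for every $\epsilon>0$ there are $\delta_0\in(0,1)$ and a profile $(\sigma^*,\tau^*)$ such that for all $\delta\in[\delta_0,1)$: $\gamma^\delta_S(\tilde\sigma,\tau^*)\le\gamma^\delta_S(\sigma^*,\tau^*)+\epsilon$ for every sender strategy $\tilde\sigma$, $\gamma^\delta_R(\sigma^*,\tilde\tau)\le\gamma^\delta_R(\sigma^*,\tau^*)+\epsilon$ for every receiver strategy $\tilde\tau$, and $\max_i|\gamma^\delta_i(\sigma^*,\tau^*)-e_i|\le\epsilon$. Then for every uniform equilibrium payoff $e$ there is an outcome $\nu\in\Delta(\Omega\times A)$ such that 1. $\sum_a\nu(\omega,a)=\mu(\omega)$ for all $\omega$; 2. $e_i=\sum_{\omega,a}\nu(\omega,a)u_i(\omega,a)$ for $i\in\{S,R\}$; 3. $\nu$ is obedient: $\sum_\omega\nu(\omega,a)\big(u_R(\omega,a)-u_R(\omega,a')\big)\ge0$ for all $a,a'\in A$; 4. $\nu$ is robust to copula deviations: for every $c\in\Delta(\Omega\times\Omega)$ both of whose marginals equal $\mu$, the outcome $\tilde\nu(\omega,a)=\sum_{\omega':\mu(\omega')>0}\frac{c(\omega,\omega')}{\mu(\omega')}\,\nu(\omega',a)$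 satisfies $\sum_{\omega,a}\tilde\nu(\omega,a)u_S(\omega,a)\le\sum_{\omega,a}\nu(\omega,a)u_S(\omega,a)$. In particular, every outcome $\nu$ satisfying 1–4 is a Bayes correlated equilibrium at prior $\mu$: there is a decision rule $d:\Omega\to\Delta(A)$ with $\nu(\omega,a)=\mu(\omega)d(a\mid\omega)$ for all $\omega,a$ and $\sum_\omega\mu(\omega)d(a\mid\omega)u_R(\omega,a)\ge\sum_\omega\mu(\omega)d(a\mid\omega)u_R(\omega,a')$ for all $a,a'\in A$. -/

import Mathlib

open MeasureTheory ProbabilityTheory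

noncomputable section

namespace DynamicPersuasion

/-! ### The state process

Probability distributions on a finite set `X` are elements of `stdSimplex ℝ X`.
A transition rule is `Q : Ω → stdSimplex ℝ Ω`, where `Q w w'` is the probability of moving
from the state `w` to the state `w'`. -/

/-- The transition matrix of the chain; rows are indexed by the current state. -/
def transitionMatrix {Ω : Type*} [Fintype Ω] (Q : Ω → stdSimplex ℝ Ω) : Matrix Ω Ω ℝ :=
  Matrix.of fun w w' => Q w w'

/-- The chain is aperiodic: for every state, the only common divisor of the possible return
times is `1`. -/
def IsAperiodic {Ω : Type*} [Fintype Ω] [DecidableEq Ω] (Q : Ω → stdSimplex ℝ Ω) : Prop :=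
  ∀ (w : Ω) (d : ℕ), (∀ n : ℕ, 0 < n → 0 < (transitionMatrix Q ^ n) w w → d ∣ n) → d = 1

/-- The chain is pseudo-renewal: the probability of moving between two distinct states depends
on the destination only, through nonnegative weights whose sum is at most `1`. -/
def IsPseudoRenewal {Ω : Type*} [Fintype Ω] (Q : Ω → stdSimplex ℝ Ω) : Prop :=
  ∃ β : Ω → ℝ, (∀ w, 0 ≤ β w) ∧ ∑ w, β w ≤ 1 ∧ ∀ w w' : Ω, w ≠ w' → Q w' w = β w

/-- `μ` is an invariant distribution of the chain. -/
def IsInvariant {Ω : Type*} [Fintype Ω] (Q : Ω → stdSimplex ℝ Ω) (μ : stdSimplex ℝ Ω) : Prop :=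
  ∀ w' : Ω, ∑ w, μ w * Q w w' = μ w'

/-! ### The dynamic game

Periods are numbered from `0`. -/

/-- A behavior strategy of the sender: the law of the message, given the past states and
messages and the current state. -/
abbrev SenderStrategy (Ω M : Type*) [Fintype M] : Type _ :=
  ∀ n : ℕ, (Fin n → Ω × M) → Ω → stdSimplex ℝ M

/-- A behavior strategy of the receiver: the law of the action, given the past messages and
actions and the current message. -/
abbrev ReceiverStrategy (M A : Type*) [Fintype A] : Type _ :=
  ∀ n : ℕ, (Fin n → M × A) → M → stdSimplex ℝ A

/-- What happens in one period: a state, a message and an action. -/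
def Stage (Ω M A : Type*) : Type _ := Ω × M × A

namespace Stage

variable {Ω M A : Type*}

def state (x : Stage Ω M A) : Ω := x.1
def message (x : Stage Ω M A) : M := x.2.1
def action (x : Stage Ω M A) : A := x.2.2

instance [Fintype Ω] [Fintype M] [Fintype A] : Fintype (Stage Ω M A) :=
  inferInstanceAs (Fintype (Ω × M × A))

instance : MeasurableSpace (Stage Ω M A) := ⊤

instance : DiscreteMeasurableSpace (Stage Ω M A) := ⟨fun _ => trivial⟩

end Stage

/-- The measure on a finite discrete space given by a point of the simplex. -/
def simplexMeasure {X : Type*} [Fintype X] [MeasurableSpace X] (p : stdSimplex ℝ X) :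
    Measure X :=
  ∑ x, ENNReal.ofReal (p x) • Measure.dirac x

instance {X : Type*} [Fintype X] [MeasurableSpace X] (p : stdSimplex ℝ X) :
    IsProbabilityMeasure (simplexMeasure p) := by
  constructor
  simp only [simplexMeasure, Measure.coe_finsetSum, Finset.sum_apply, Measure.smul_apply,
    measure_univ, smul_eq_mul, mul_one]
  rw [← ENNReal.ofReal_sum_of_nonneg fun x _ => stdSimplex.zero_le p x,
    stdSimplex.sum_eq_one, ENNReal.ofReal_one]

/-- The law of one period when the state has law `p`, the message has law `s ω` given the
state `ω`, and the action has law `t m` given the message `m`. -/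
def stageLaw {Ω M A : Type*} [Fintype Ω] [Fintype M] [Fintype A] (p : stdSimplex ℝ Ω)
    (s : Ω → stdSimplex ℝ M) (t : M → stdSimplex ℝ A) : stdSimplex ℝ (Stage Ω M A) :=
  ⟨fun x => p x.state * s x.state x.message * t x.message x.action, by
    refine ⟨fun x => mul_nonneg (mul_nonneg (stdSimplex.zero_le _ _) (stdSimplex.zero_le _ _))
      (stdSimplex.zero_le _ _), ?_⟩
    change ∑ x : Ω × M × A, p x.1 * s x.1 x.2.1 * t x.2.1 x.2.2 = 1
    simp [Fintype.sum_prod_type, ← Finset.mul_sum]⟩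

section Play

variable {Ω M A : Type*} [Fintype Ω] [Fintype M] [Fintype A]

/-- The law of period `n + 1` given the play `h` of the periods `0, …, n`. -/
def nextStageLaw (Q : Ω → stdSimplex ℝ Ω) (σ : SenderStrategy Ω M) (τ : ReceiverStrategy M A)
    (n : ℕ) (h : Finset.Iic n → Stage Ω M A) : stdSimplex ℝ (Stage Ω M A) :=
  let past : Fin (n + 1) → Stage Ω M A :=
    fun i => h ⟨i, Finset.mem_Iic.2 (Nat.lt_succ_iff.1 i.2)⟩
  stageLaw (Q (past (Fin.last n)).state)
    (σ (n + 1) fun i => ((past i).state, (past i).message))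
    (τ (n + 1) fun i => ((past i).message, (past i).action))

/-- `nextStageLaw` as a Markov kernel from finite plays to stages. -/
def nextStageKernel (Q : Ω → stdSimplex ℝ Ω) (σ : SenderStrategy Ω M)
    (τ : ReceiverStrategy M A) (n : ℕ) :
    Kernel (Finset.Iic n → Stage Ω M A) (Stage Ω M A) :=
  Kernel.ofFunOfCountable fun h => simplexMeasure (nextStageLaw Q σ τ n h)

instance (Q : Ω → stdSimplex ℝ Ω) (σ : SenderStrategy Ω M) (τ : ReceiverStrategy M A) (n : ℕ) :
    IsMarkovKernel (nextStageKernel Q σ τ n) :=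
  ⟨fun h => inferInstanceAs (IsProbabilityMeasure (simplexMeasure (nextStageLaw Q σ τ n h)))⟩

/-- The law of the infinite play under the profile `(σ, τ)`, when the initial state is drawn
from `μ` and the state moves according to `Q`. -/
def playLaw (μ : stdSimplex ℝ Ω) (Q : Ω → stdSimplex ℝ Ω) (σ : SenderStrategy Ω M)
    (τ : ReceiverStrategy M A) : Measure (ℕ → Stage Ω M A) :=
  Kernel.trajMeasure (X := fun _ => Stage Ω M A)
    (simplexMeasure (stageLaw μ (σ 0 Fin.elim0) (τ 0 Fin.elim0)))
    (nextStageKernel Q σ τ)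

/-- The expected `δ`-discounted payoff for the stage payoff function `u`. -/
def discountedPayoff (μ : stdSimplex ℝ Ω) (Q : Ω → stdSimplex ℝ Ω) (u : Ω → A → ℝ) (δ : ℝ)
    (σ : SenderStrategy Ω M) (τ : ReceiverStrategy M A) : ℝ :=
  ∫ x, (1 - δ) * ∑' n : ℕ, δ ^ n * u (x n).state (x n).action ∂(playLaw μ Q σ τ)

end Play

/-- `e = (e_S, e_R)` is a uniform equilibrium payoff of the dynamic game with message set `M`.
The norm of `ℝ × ℝ` is the maximum norm. -/
def IsUniformEquilibriumPayoff {Ω A : Type*} (M : Type*) [Fintype Ω] [Fintype M] [Fintype A]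
    (μ : stdSimplex ℝ Ω) (Q : Ω → stdSimplex ℝ Ω) (uS uR : Ω → A → ℝ) (e : ℝ × ℝ) : Prop :=
  ∀ ε : ℝ, 0 < ε → ∃ δ₀ : ℝ, 0 < δ₀ ∧ δ₀ < 1 ∧
    ∃ (σ : SenderStrategy Ω M) (τ : ReceiverStrategy M A), ∀ δ : ℝ, δ₀ ≤ δ → δ < 1 →
      (∀ σ' : SenderStrategy Ω M,
        discountedPayoff μ Q uS δ σ' τ ≤ discountedPayoff μ Q uS δ σ τ + ε) ∧
      (∀ τ' : ReceiverStrategy M A,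
        discountedPayoff μ Q uR δ σ τ' ≤ discountedPayoff μ Q uR δ σ τ + ε) ∧
      ‖(discountedPayoff μ Q uS δ σ τ, discountedPayoff μ Q uR δ σ τ) - e‖ ≤ ε

/-! ### Outcomes -/

section Outcome

variable {Ω A : Type*} [Fintype Ω] [Fintype A]

/-- The expectation of `u` under the outcome `ν`. -/
def outcomePayoff (ν : stdSimplex ℝ (Ω × A)) (u : Ω → A → ℝ) : ℝ :=
  ∑ w, ∑ a, ν (w, a) * u w a

/-- The state marginal (the prior) of an outcome. -/
def stateMarginal (ν : stdSimplex ℝ (Ω × A)) (w : Ω) : ℝ := ∑ a, ν (w, a)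

/-- The copulas with both marginals equal to `π`. -/
def copulas (π : Ω → ℝ) : Set (stdSimplex ℝ (Ω × Ω)) :=
  {c | (∀ w, ∑ w', c (w, w') = π w) ∧ ∀ w', ∑ w, c (w, w') = π w'}

/-- The copula deviations from `ν`: the outcomes `(w, a) ↦ ∑ w', c(w | w') ν(w', a)`, where
`c(w | w') = c(w, w') / π(w')` and `c` is a copula whose marginals are the prior `π` of `ν`.
Where `π(w') = 0`, also `ν(w', a) = 0`, so the value of `c(w | w')` is irrelevant. -/
def copulaDeviations (ν : stdSimplex ℝ (Ω × A)) : Set (stdSimplex ℝ (Ω × A)) :=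
  {ν' | ∃ c ∈ copulas (stateMarginal ν),
    ∀ w a, ν' (w, a) = ∑ w', c (w, w') / stateMarginal ν w' * ν (w', a)}

/-- No copula deviation raises the sender's expected payoff. -/
def IsRobustToCopulaDeviations (uS : Ω → A → ℝ) (ν : stdSimplex ℝ (Ω × A)) : Prop :=
  ∀ ν' ∈ copulaDeviations ν, outcomePayoff ν' uS ≤ outcomePayoff ν uS

/-- The receiver has no incentive to replace a recommended action by another one. -/
def IsObedient (uR : Ω → A → ℝ) (ν : stdSimplex ℝ (Ω × A)) : Prop :=
  ∀ a a' : A, 0 ≤ ∑ w, ν (w, a) * (uR w a - uR w a')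

/-- `ν` is a Bayes correlated equilibrium outcome, at the prior `π`, of the decision problem of
the receiver without further information: it is induced by an obedient decision rule. -/
def IsBayesCorrelatedEquilibrium (π : stdSimplex ℝ Ω) (uR : Ω → A → ℝ)
    (ν : stdSimplex ℝ (Ω × A)) : Prop :=
  ∃ d : Ω → stdSimplex ℝ A, (∀ w a, ν (w, a) = π w * d w a) ∧
    ∀ a a' : A, ∑ w, π w * d w a * uR w a' ≤ ∑ w, π w * d w a * uR w a

end Outcome

end DynamicPersuasion

end

/-!
The outcome is a limit of discounted outcomes. For a profile `(σ, τ)` and `δ < 1`, let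
`ν_δ = (1 - δ) ∑ n, δ ^ n * law (ω_n, a_n)`. Its state marginal is `μ` because `μ` is invariant, and
the discounted payoffs are its expectations (`discountedPayoff_eq`). If `(σ, τ)` is an
`ε`-equilibrium at `δ`, then `ν_δ` satisfies obedience and robustness up to `ε`
(`exists_approximate_outcome`). As the simplex is compact and all requirements are closed
conditions, a limit point for `ε → 0` satisfies them exactly.

Everything rests on the law of `(ω_n, a_n)`, a finite sum over messages of the product of
`signalLaw`, a factor of the sender, and `response`, a factor of the receiver; the product form
expresses that the sender does not observe the actions.

* *Obedience* (`exists_receiver_deviation`). The receiver can replace the action `a` by `f a` in all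
  periods. As actions have no influence on the messages, it suffices that he plays in each period
  the image under `f` of the law of the prescribed action given the messages.
* *Robustness* (`exists_sender_deviation`). A pseudo-renewal chain stays put with some probability
  `l` and otherwise redraws the state from `μ` (`IsPseudoRenewal.exists_lazy`). Given a copula `c`,
  run the chain of pairs that stays put with probability `l` and otherwise redraws the pair from
  `c`. Its second component is again a chain with transition `Q` started at `μ`, and the first
  component, given the second one up to now, has law `c(· | w')`, where `w'` is the current value of
  the second (`sum_pathLaw_coupledStep`). A sender who plays `σ` on the second component turns the
  law of `(ω_n, a_n)` into its copula deviation in every period. A behavior strategy with the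
  same effect exists by Kuhn's theorem (`exists_sender_strategy`).

The last assertion of the theorem is disintegration of `ν` over the states, since irreducibility
makes `μ` strictly positive (`invariant_pos`).
-/

open MeasureTheory ProbabilityTheory

noncomputable section

namespace DynamicPersuasion

/-! ### Laws of finite paths -/

/-- The weight of a finite path when the conditional weight of its `n`-th entry, given the first
`n` entries, is `step n`. -/
def pathLaw {X : Type*} (step : ∀ n : ℕ, (Fin n → X) → X → ℝ) : ∀ n : ℕ, (Fin n → X) → ℝ
  | 0, _ => 1
  | n + 1, h => pathLaw step n (fun i => h i.castSucc) *
      step n (fun i => h i.castSucc) (h (Fin.last n))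

section PathLaw

variable {X : Type*} (step : ∀ n : ℕ, (Fin n → X) → X → ℝ)

lemma pathLaw_snoc (n : ℕ) (h : Fin n → X) (x : X) :
    pathLaw step (n + 1) (Fin.snoc (α := fun _ => X) h x) = pathLaw step n h * step n h x := by
  simp [pathLaw]

lemma pathLaw_nonneg (hs : ∀ n h x, 0 ≤ step n h x) (n : ℕ) (h : Fin n → X) :
    0 ≤ pathLaw step n h := by
  induction n with
  | zero => exact zero_le_one
  | succ n ih => exact mul_nonneg (ih _) (hs _ _ _)

lemma sum_path_succ [Fintype X] {n : ℕ} (f : (Fin (n + 1) → X) → ℝ) :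
    ∑ h, f h = ∑ h : Fin n → X, ∑ x, f (Fin.snoc (α := fun _ => X) h x) := by
  rw [← (Fin.snocEquiv fun _ : Fin (n + 1) => X).sum_comp, Fintype.sum_prod_type_right]
  rfl

end PathLaw

/-! ### The play in finitely many periods -/

/-- The stage with the given state, message and action. -/
def Stage.mk {Ω M A : Type*} (w : Ω) (m : M) (a : A) : Stage Ω M A := (w, m, a)

lemma Stage.state_mk {Ω M A : Type*} (w : Ω) (m : M) (a : A) : (Stage.mk w m a).state = w := rfl

lemma Stage.message_mk {Ω M A : Type*} (w : Ω) (m : M) (a : A) :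
    (Stage.mk w m a).message = m := rfl

lemma Stage.action_mk {Ω M A : Type*} (w : Ω) (m : M) (a : A) :
    (Stage.mk w m a).action = a := rfl

section Play

variable {Ω M A : Type*} [Fintype Ω] [Fintype M] [Fintype A]

/-- The law of the state in period `n`, given the states of the previous periods. -/
def stateStep (μ : stdSimplex ℝ Ω) (Q : Ω → stdSimplex ℝ Ω) :
    ∀ n : ℕ, (Fin n → Ω) → stdSimplex ℝ Ω
  | 0, _ => μ
  | n + 1, w => Q (w (Fin.last n))

lemma stateStep_succ (μ : stdSimplex ℝ Ω) (Q : Ω → stdSimplex ℝ Ω) (n : ℕ)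
    (w : Fin (n + 1) → Ω) : stateStep μ Q (n + 1) w = Q (w (Fin.last n)) := rfl

/-- The law of period `n` given the play of the previous periods. -/
def playStep (μ : stdSimplex ℝ Ω) (Q : Ω → stdSimplex ℝ Ω) (σ : SenderStrategy Ω M)
    (τ : ReceiverStrategy M A) (n : ℕ) (h : Fin n → Stage Ω M A) : stdSimplex ℝ (Stage Ω M A) :=
  stageLaw (stateStep μ Q n fun i => (h i).state)
    (σ n fun i => ((h i).state, (h i).message)) (τ n fun i => ((h i).message, (h i).action))

/-- The joint law of the state and the message of period `n`, given the previous states and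
messages. -/
def senderStep (μ : stdSimplex ℝ Ω) (Q : Ω → stdSimplex ℝ Ω) (σ : SenderStrategy Ω M) (n : ℕ)
    (h : Fin n → Ω × M) (x : Ω × M) : ℝ :=
  stateStep μ Q n (fun i => (h i).1) x.1 * σ n h x.1 x.2

/-- The conditional weight of the action of period `n`, given the previous messages and actions
and the current message. -/
def receiverStep (τ : ReceiverStrategy M A) (n : ℕ) (h : Fin n → M × A) (x : M × A) : ℝ :=
  τ n h x.1 x.2

lemma senderStep_nonneg (μ : stdSimplex ℝ Ω) (Q : Ω → stdSimplex ℝ Ω) (σ : SenderStrategy Ω M)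
    (n : ℕ) (h : Fin n → Ω × M) (x : Ω × M) : 0 ≤ senderStep μ Q σ n h x :=
  mul_nonneg (stdSimplex.zero_le _ _) (stdSimplex.zero_le _ _)

/-- The states and messages do not depend on the actions, and the actions depend on the states
through the messages only; so the law of a play splits into a factor of the sender and a factor of
the receiver. -/
lemma pathLaw_playStep (μ : stdSimplex ℝ Ω) (Q : Ω → stdSimplex ℝ Ω) (σ : SenderStrategy Ω M)
    (τ : ReceiverStrategy M A) (n : ℕ) (h : Fin n → Stage Ω M A) :
    pathLaw (fun n h x => playStep μ Q σ τ n h x) n h =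
      pathLaw (senderStep μ Q σ) n (fun i => ((h i).state, (h i).message)) *
        pathLaw (receiverStep τ) n (fun i => ((h i).message, (h i).action)) := by
  induction n with
  | zero => simp [pathLaw]
  | succ n ih =>
    simp only [pathLaw]
    rw [ih]
    change _ * (stateStep μ Q n _ _ * σ n _ _ _ * τ n _ _ _) =
      (_ * (stateStep μ Q n _ _ * σ n _ _ _)) * (_ * τ n _ _ _)
    ring

lemma integral_simplexMeasure {X : Type*} [Fintype X] [MeasurableSpace X]
    [MeasurableSingletonClass X] (p : stdSimplex ℝ X) (f : X → ℝ) :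
    ∫ x, f x ∂simplexMeasure p = ∑ x, p x * f x := by
  rw [simplexMeasure, integral_finsetSum_measure]
  · refine Finset.sum_congr rfl fun x _ => ?_
    rw [integral_smul_measure, integral_dirac,
      ENNReal.toReal_ofReal (stdSimplex.zero_le p x), smul_eq_mul]
  · intro x _
    exact (integrable_dirac (by simp)).smul_measure ENNReal.ofReal_ne_top

instance (μ : stdSimplex ℝ Ω) (Q : Ω → stdSimplex ℝ Ω) (σ : SenderStrategy Ω M)
    (τ : ReceiverStrategy M A) : IsProbabilityMeasure (playLaw μ Q σ τ) :=
  inferInstanceAs (IsProbabilityMeasure (Kernel.trajMeasure (X := fun _ => Stage Ω M A) _ _))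

lemma map_zero_playLaw (μ : stdSimplex ℝ Ω) (Q : Ω → stdSimplex ℝ Ω)
    (σ : SenderStrategy Ω M) (τ : ReceiverStrategy M A) :
    (playLaw μ Q σ τ).map (fun x => x 0) =
      simplexMeasure (stageLaw μ (σ 0 Fin.elim0) (τ 0 Fin.elim0)) := by
  have hf : (fun x : ℕ → Stage Ω M A => x 0) =
      (fun y : Finset.Iic 0 → Stage Ω M A => y ⟨0, Finset.mem_Iic.2 le_rfl⟩) ∘
        Preorder.frestrictLe (π := fun _ => Stage Ω M A) 0 := rfl
  rw [playLaw, Kernel.trajMeasure, Measure.map_comp _ _ (by fun_prop), hf,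
    Kernel.map_comp_right _ (Preorder.measurable_frestrictLe 0) (measurable_pi_apply _), Kernel.traj_map_frestrictLe,
    Kernel.partialTraj_self, ← Measure.map_comp _ _ (by fun_prop), Measure.id_comp,
    Measure.map_map (by fun_prop) (by fun_prop)]
  exact Measure.map_id

/-- The expectation of a function of the first `n` periods is a finite sum. -/
lemma integral_playLaw (μ : stdSimplex ℝ Ω) (Q : Ω → stdSimplex ℝ Ω)
    (σ : SenderStrategy Ω M) (τ : ReceiverStrategy M A) :
    ∀ (n : ℕ) (g : (Fin n → Stage Ω M A) → ℝ),
      ∫ x, g (fun i => x i) ∂playLaw μ Q σ τ =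
        ∑ h, pathLaw (fun n h x => playStep μ Q σ τ n h x) n h * g h
  | 0, g => by
    simp only [pathLaw, one_mul, Finset.univ_unique, Finset.sum_singleton]
    rw [show (fun x : ℕ → Stage Ω M A => g fun i : Fin 0 => x i) = fun _ => g default from
      funext fun x => congrArg g (Subsingleton.elim _ _)]
    simp
  | 1, g => by
    have h1 : ∫ x, g (fun i => x i) ∂playLaw μ Q σ τ =
        ∫ y, g (fun _ => y) ∂((playLaw μ Q σ τ).map fun x => x 0) := by
      rw [integral_map (measurable_pi_apply 0).aemeasurable .of_discrete]
      refine integral_congr_ae (Filter.Eventually.of_forall fun x => congrArg g ?_)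
      funext i
      rw [Subsingleton.elim i 0]
      rfl
    rw [h1, map_zero_playLaw, integral_simplexMeasure, sum_path_succ]
    simp only [Finset.univ_unique, Finset.sum_singleton, pathLaw_snoc]
    refine Finset.sum_congr rfl fun y _ => ?_
    congr 1
    · simp only [pathLaw, one_mul]
      rw [playStep]
      congr 3 <;> exact Subsingleton.elim _ _
  | n + 2, g => by
    have hstep := Kernel.map_frestrictLe_trajMeasure_compProd_eq_map_trajMeasure
      (X := fun _ => Stage Ω M A) (κ := nextStageKernel Q σ τ)
      (μ₀ := simplexMeasure (stageLaw μ (σ 0 Fin.elim0) (τ 0 Fin.elim0))) (a := n)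
    -- `r` turns plays indexed by `Finset.Iic n` into plays indexed by `Fin (n + 1)`.
    let r : (Finset.Iic n → Stage Ω M A) → (Fin (n + 1) → Stage Ω M A) :=
      fun h i => h ⟨i, Finset.mem_Iic.2 (Nat.lt_succ_iff.1 i.2)⟩
    let f : (Finset.Iic n → Stage Ω M A) × Stage Ω M A → ℝ :=
      fun y => g (Fin.snoc (α := fun _ => Stage Ω M A) (r y.1) y.2)
    let G : (Fin (n + 1) → Stage Ω M A) → ℝ := fun h =>
      ∑ y, playStep μ Q σ τ (n + 1) h y * g (Fin.snoc (α := fun _ => Stage Ω M A) h y)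
    have hr : ∀ x : ℕ → Stage Ω M A,
        (fun i : Fin (n + 2) => x i) =
          Fin.snoc (α := fun _ => Stage Ω M A)
            (r (Preorder.frestrictLe (π := fun _ => Stage Ω M A) n x)) (x (n + 1)) := by
      intro x
      funext i
      refine Fin.lastCases ?_ (fun j => ?_) i
      · simp
      · simp [r]
    have hG : ∫ x, g (fun i => x i) ∂playLaw μ Q σ τ =
        ∫ x, G (fun i => x i) ∂playLaw μ Q σ τ := by
      calc ∫ x, g (fun i => x i) ∂playLaw μ Q σ τ
          = ∫ x, f (Preorder.frestrictLe (π := fun _ => Stage Ω M A) n x, x (n + 1))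
              ∂playLaw μ Q σ τ := by
            refine integral_congr_ae (Filter.Eventually.of_forall fun x => ?_)
            exact congrArg g (hr x)
        _ = ∫ y, f y ∂((playLaw μ Q σ τ).map fun x =>
              (Preorder.frestrictLe (π := fun _ => Stage Ω M A) n x, x (n + 1))) := by
            rw [integral_map (by fun_prop) (by fun_prop)]
        _ = ∫ h, ∫ y, f (h, y) ∂(nextStageKernel Q σ τ n h)
              ∂((playLaw μ Q σ τ).map
                (Preorder.frestrictLe (π := fun _ => Stage Ω M A) n)) := by
            rw [playLaw, ← hstep]
            have := Measure.isProbabilityMeasure_map (μ := playLaw μ Q σ τ)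
              (f := Preorder.frestrictLe (π := fun _ => Stage Ω M A) n) (by fun_prop)
            rw [playLaw] at this
            exact Measure.integral_compProd Integrable.of_finite
        _ = ∫ x, G (fun i => x i) ∂playLaw μ Q σ τ := by
            rw [integral_map (by fun_prop) (by fun_prop)]
            refine integral_congr_ae (Filter.Eventually.of_forall fun x => ?_)
            exact integral_simplexMeasure (nextStageLaw Q σ τ n _) _
    rw [hG, integral_playLaw μ Q σ τ (n + 1) G, sum_path_succ (n := n + 1)]
    refine Finset.sum_congr rfl fun h _ => ?_
    simp only [G, Finset.mul_sum, pathLaw_snoc, mul_assoc]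

end Play

/-! ### The law of the state and the action in one period -/

section Period

variable {Ω M A : Type*} [Fintype Ω] [Fintype M] [Fintype A]

/-- The probability that the state of period `n` is `w` and the messages up to period `n` are
`m, m'`. -/
def signalLaw (μ : stdSimplex ℝ Ω) (Q : Ω → stdSimplex ℝ Ω) (σ : SenderStrategy Ω M) (n : ℕ)
    (w : Ω) (m : Fin n → M) (m' : M) : ℝ :=
  ∑ v : Fin n → Ω, pathLaw (senderStep μ Q σ) n (fun i => (v i, m i)) *
    senderStep μ Q σ n (fun i => (v i, m i)) (w, m')

/-- The probability that the action of period `n` is `a` when the messages up to period `n` are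
`m, m'`; the past actions are averaged out. -/
def response (τ : ReceiverStrategy M A) (n : ℕ) (m : Fin n → M) (m' : M) (a : A) : ℝ :=
  ∑ b : Fin n → A, pathLaw (receiverStep τ) n (fun i => (m i, b i)) *
    receiverStep τ n (fun i => (m i, b i)) (m', a)

/-- The probability that in period `n` the state is `w` and the action is `a`. -/
def periodLaw (μ : stdSimplex ℝ Ω) (Q : Ω → stdSimplex ℝ Ω) (σ : SenderStrategy Ω M)
    (τ : ReceiverStrategy M A) (n : ℕ) (w : Ω) (a : A) : ℝ :=
  ∑ m : Fin n → M, ∑ m', signalLaw μ Q σ n w m m' * response τ n m m' a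

lemma sum_stage (f : Stage Ω M A → ℝ) :
    ∑ x, f x = ∑ w, ∑ m, ∑ a, f (Stage.mk w m a) := by
  let e : Ω × M × A ≃ Stage Ω M A := Equiv.refl _
  rw [← e.sum_comp]
  simp only [Fintype.sum_prod_type]
  rfl

lemma sum_stage_path {n : ℕ} (f : (Fin n → Stage Ω M A) → ℝ) :
    ∑ h, f h = ∑ v : Fin n → Ω, ∑ m : Fin n → M, ∑ b : Fin n → A,
      f fun i => Stage.mk (v i) (m i) (b i) := by
  let e : (Fin n → Ω) × (Fin n → M) × (Fin n → A) ≃ (Fin n → Stage Ω M A) :=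
    { toFun := fun p i => Stage.mk (p.1 i) (p.2.1 i) (p.2.2 i)
      invFun := fun h => (fun i => (h i).state, fun i => (h i).message, fun i => (h i).action)
      left_inv := fun _ => rfl
      right_inv := fun _ => rfl }
  rw [← e.sum_comp]
  simp only [Fintype.sum_prod_type]
  rfl

lemma sum_signal_response {I J K : Type*} [Fintype I] [Fintype J] [Fintype K]
    (S : I → J → Ω → M → ℝ) (R : J → K → M → A → ℝ) (u : Ω → A → ℝ) :
    ∑ i, ∑ j, ∑ k, ∑ w, ∑ m, ∑ a, S i j w m * R j k m a * u w a =
      ∑ w, ∑ a, (∑ j, ∑ m, (∑ i, S i j w m) * ∑ k, R j k m a) * u w a := by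
  simp only [Finset.sum_mul_sum]
  simp only [Finset.sum_mul]
  simp only [← Finset.sum_product', Finset.univ_product_univ]
  refine Finset.sum_nbij' (fun p => (p.2.2.2.1, p.2.2.2.2.2, p.2.1, p.2.2.2.2.1, p.1, p.2.2.1))
    (fun q => (q.2.2.2.2.1, q.2.2.1, q.2.2.2.2.2, q.1, q.2.2.2.1, q.2.1)) ?_ ?_ ?_ ?_ ?_ <;> simp

lemma integral_period (μ : stdSimplex ℝ Ω) (Q : Ω → stdSimplex ℝ Ω) (σ : SenderStrategy Ω M)
    (τ : ReceiverStrategy M A) (u : Ω → A → ℝ) (n : ℕ) :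
    ∫ x, u (x n).state (x n).action ∂playLaw μ Q σ τ =
      ∑ w, ∑ a, periodLaw μ Q σ τ n w a * u w a := by
  have h := integral_playLaw μ Q σ τ (n + 1)
    fun h => u (h (Fin.last n)).state (h (Fin.last n)).action
  simp only [Fin.val_last] at h
  rw [h, sum_path_succ, sum_stage_path]
  simp only [sum_stage, pathLaw_snoc, pathLaw_playStep, Fin.snoc_last]
  simp only [Stage.state_mk, Stage.message_mk, Stage.action_mk]
  simp only [periodLaw, signalLaw, response]
  refine Eq.trans ?_ (sum_signal_response
    (S := fun (v : Fin n → Ω) (m : Fin n → M) w m' => pathLaw (senderStep μ Q σ) n (fun i => (v i, m i)) *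
      senderStep μ Q σ n (fun i => (v i, m i)) (w, m'))
    (R := fun (m : Fin n → M) (b : Fin n → A) m' a => pathLaw (receiverStep τ) n (fun i => (m i, b i)) *
      receiverStep τ n (fun i => (m i, b i)) (m', a)) u)
  refine Finset.sum_congr rfl fun v _ => Finset.sum_congr rfl fun m _ =>
    Finset.sum_congr rfl fun b _ => Finset.sum_congr rfl fun w _ =>
    Finset.sum_congr rfl fun m' _ => Finset.sum_congr rfl fun a _ => ?_
  change pathLaw (senderStep μ Q σ) n _ * pathLaw (receiverStep τ) n _ *
    (stateStep μ Q n _ w * σ n _ w m' * τ n _ m' a) * u w a =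
    pathLaw (senderStep μ Q σ) n _ * (stateStep μ Q n _ w * σ n _ w m') *
    (pathLaw (receiverStep τ) n _ * τ n _ m' a) * u w a
  simp only [Stage.state_mk, Stage.message_mk, Stage.action_mk]
  ring

/-! ### Marginals -/

lemma sum_pathLaw_receiverStep {M : Type*} (τ : ReceiverStrategy M A) (n : ℕ) (m : Fin n → M) :
    ∑ b : Fin n → A, pathLaw (receiverStep τ) n (fun i => (m i, b i)) = 1 := by
  induction n with
  | zero => simp [pathLaw]
  | succ n ih =>
    rw [sum_path_succ]
    simp [pathLaw, receiverStep, ← Finset.mul_sum, ih]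

lemma response_nonneg {M : Type*} (τ : ReceiverStrategy M A) (n : ℕ) (m : Fin n → M) (m' : M) (a : A) :
    0 ≤ response τ n m m' a :=
  Finset.sum_nonneg fun _ _ => mul_nonneg
    (pathLaw_nonneg _ (fun _ _ _ => stdSimplex.zero_le _ _) _ _) (stdSimplex.zero_le _ _)

lemma sum_response {M : Type*} (τ : ReceiverStrategy M A) (n : ℕ) (m : Fin n → M) (m' : M) :
    ∑ a, response τ n m m' a = 1 := by
  simp only [response]
  rw [Finset.sum_comm]
  simp [receiverStep, ← Finset.mul_sum, sum_pathLaw_receiverStep]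

lemma signalLaw_nonneg (μ : stdSimplex ℝ Ω) (Q : Ω → stdSimplex ℝ Ω) (σ : SenderStrategy Ω M)
    (n : ℕ) (w : Ω) (m : Fin n → M) (m' : M) : 0 ≤ signalLaw μ Q σ n w m m' :=
  Finset.sum_nonneg fun _ _ => mul_nonneg
    (pathLaw_nonneg _ (senderStep_nonneg μ Q σ) _ _) (senderStep_nonneg μ Q σ _ _ _)

lemma sum_pathLaw_senderStep (μ : stdSimplex ℝ Ω) (Q : Ω → stdSimplex ℝ Ω)
    (σ : SenderStrategy Ω M) (n : ℕ) (v : Fin n → Ω) :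
    ∑ m : Fin n → M, pathLaw (senderStep μ Q σ) n (fun i => (v i, m i)) =
      pathLaw (fun n h x => stateStep μ Q n h x) n v := by
  induction n with
  | zero => simp [pathLaw]
  | succ n ih =>
    rw [sum_path_succ]
    simp [pathLaw, senderStep, ← Finset.mul_sum, ← Finset.sum_mul, ih]

/-- Under the invariant distribution the state has the same law in all periods. -/
lemma sum_pathLaw_stateStep {μ : stdSimplex ℝ Ω} {Q : Ω → stdSimplex ℝ Ω}
    (hμ : IsInvariant Q μ) (n : ℕ) (w : Ω) :
    ∑ v : Fin n → Ω, pathLaw (fun n h x => stateStep μ Q n h x) n v * stateStep μ Q n v w =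
      μ w := by
  induction n generalizing w with
  | zero => simp [pathLaw, stateStep]
  | succ n ih =>
    rw [sum_path_succ, Finset.sum_comm, ← hμ w]
    refine Finset.sum_congr rfl fun x _ => ?_
    simp only [pathLaw_snoc]
    simp only [stateStep_succ, Fin.snoc_last, ← Finset.sum_mul, ih]

lemma periodLaw_nonneg (μ : stdSimplex ℝ Ω) (Q : Ω → stdSimplex ℝ Ω) (σ : SenderStrategy Ω M)
    (τ : ReceiverStrategy M A) (n : ℕ) (w : Ω) (a : A) : 0 ≤ periodLaw μ Q σ τ n w a :=
  Finset.sum_nonneg fun _ _ => Finset.sum_nonneg fun _ _ =>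
    mul_nonneg (signalLaw_nonneg _ _ _ _ _ _ _) (response_nonneg _ _ _ _ _)

lemma sum_periodLaw {μ : stdSimplex ℝ Ω} {Q : Ω → stdSimplex ℝ Ω} (hμ : IsInvariant Q μ)
    (σ : SenderStrategy Ω M) (τ : ReceiverStrategy M A) (n : ℕ) (w : Ω) :
    ∑ a, periodLaw μ Q σ τ n w a = μ w := by
  have h1 : ∑ a, periodLaw μ Q σ τ n w a =
      ∑ m : Fin n → M, ∑ m', signalLaw μ Q σ n w m m' := by
    simp only [periodLaw]
    rw [Finset.sum_comm]
    refine Finset.sum_congr rfl fun m _ => ?_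
    rw [Finset.sum_comm]
    refine Finset.sum_congr rfl fun m' _ => ?_
    rw [← Finset.mul_sum, sum_response, mul_one]
  rw [h1, ← sum_pathLaw_stateStep hμ n w]
  simp only [signalLaw]
  simp_rw [Finset.sum_comm (s := (Finset.univ : Finset M))]
  rw [Finset.sum_comm]
  simp [senderStep, ← Finset.mul_sum, ← Finset.sum_mul, sum_pathLaw_senderStep]

/-! ### Deviations of the receiver -/

/-- The receiver can play so that, given the messages, his action has the law of `f a`, where `a`
is the action prescribed by `τ`. As the sender does not observe the actions, it suffices that the
deviation reproduces the law of `a` given the messages; past actions can be ignored. -/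
lemma exists_receiver_deviation [DecidableEq A] (μ : stdSimplex ℝ Ω) (Q : Ω → stdSimplex ℝ Ω)
    (τ : ReceiverStrategy M A) (f : A → A) :
    ∃ τ' : ReceiverStrategy M A, ∀ (σ : SenderStrategy Ω M) (n : ℕ) (w : Ω) (b : A),
      periodLaw μ Q σ τ' n w b = ∑ a, (if f a = b then 1 else 0) * periodLaw μ Q σ τ n w a := by
  let τ' : ReceiverStrategy M A := fun n h m' =>
    ⟨fun b => ∑ a, (if f a = b then 1 else 0) * response τ n (fun i => (h i).1) m' a,
      fun b => Finset.sum_nonneg fun a _ =>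
        mul_nonneg (by split_ifs <;> norm_num) (response_nonneg _ _ _ _ _), by
      rw [Finset.sum_comm]
      simp [sum_response]⟩
  have h : ∀ n (m : Fin n → M) m' b, response τ' n m m' b =
      ∑ a, (if f a = b then 1 else 0) * response τ n m m' a := by
    intro n m m' b
    change ∑ d : Fin n → A, _ * ∑ a, (if f a = b then 1 else 0) * response τ n m m' a = _
    rw [← Finset.sum_mul, sum_pathLaw_receiverStep, one_mul]
  refine ⟨τ', fun σ n w b => ?_⟩
  simp only [periodLaw, h, Finset.mul_sum]
  rw [Finset.sum_comm (γ := A)]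
  refine Finset.sum_congr rfl fun m _ => ?_
  rw [Finset.sum_comm (γ := A)]
  refine Finset.sum_congr rfl fun m' _ => Finset.sum_congr rfl fun a _ => ?_
  ring

end Period

/-! ### Deviations of the sender -/

section Sender

variable {Ω M A : Type*} [Fintype Ω] [Fintype M] [Fintype A]

/-- The conditional weight of the message of period `n`, given the previous states and messages
and the current state. -/
def messageStep (σ : SenderStrategy Ω M) (n : ℕ) (h : Fin n → Ω × M) (x : Ω × M) : ℝ :=
  σ n h x.1 x.2

lemma pathLaw_messageStep_nonneg {Ω : Type*} (σ : SenderStrategy Ω M) (n : ℕ) (h : Fin n → Ω × M) :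
    0 ≤ pathLaw (messageStep σ) n h :=
  pathLaw_nonneg _ (fun _ _ _ => stdSimplex.zero_le _ _) _ _

lemma pathLaw_senderStep (μ : stdSimplex ℝ Ω) (Q : Ω → stdSimplex ℝ Ω)
    (σ : SenderStrategy Ω M) (n : ℕ) (h : Fin n → Ω × M) :
    pathLaw (senderStep μ Q σ) n h =
      pathLaw (fun n v x => stateStep μ Q n v x) n (fun i => (h i).1) *
        pathLaw (messageStep σ) n h := by
  induction n with
  | zero => simp [pathLaw]
  | succ n ih =>
    simp only [pathLaw, ih, senderStep, messageStep]
    ring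

/-- Kuhn's theorem for the sender: if the joint weights `V` of states and messages leave the law
of the states unchanged given past states and past messages, then a behavior strategy induces
them. -/
lemma exists_sender_strategy (μ : stdSimplex ℝ Ω) (Q : Ω → stdSimplex ℝ Ω)
    (σ₀ : SenderStrategy Ω M) (V : ∀ n : ℕ, (Fin n → Ω × M) → ℝ) (hV0 : ∀ h, V 0 h = 1)
    (hV : ∀ n h, 0 ≤ V n h)
    (hVs : ∀ n h w, ∑ m, V (n + 1) (Fin.snoc (α := fun _ => Ω × M) h (w, m)) =
      V n h * stateStep μ Q n (fun i => (h i).1) w) :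
    ∃ σ : SenderStrategy Ω M, ∀ n h, pathLaw (senderStep μ Q σ) n h = V n h := by
  classical
  let D : ∀ n : ℕ, (Fin n → Ω × M) → Ω → ℝ := fun n h w =>
    V n h * stateStep μ Q n (fun i => (h i).1) w
  -- The conditional law of the message under `V`; it is arbitrary on null histories.
  let σ : SenderStrategy Ω M := fun n h w =>
    if hD : D n h w = 0 then σ₀ n h w else
      ⟨fun m => V (n + 1) (Fin.snoc (α := fun _ => Ω × M) h (w, m)) / D n h w,
        fun m => div_nonneg (hV _ _) (mul_nonneg (hV _ _) (stdSimplex.zero_le _ _)), by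
        rw [← Finset.sum_div, hVs]
        exact div_self hD⟩
  have hσ : ∀ n h w m, D n h w * σ n h w m =
      V (n + 1) (Fin.snoc (α := fun _ => Ω × M) h (w, m)) := by
    intro n h w m
    by_cases hD : D n h w = 0
    · have hle : V (n + 1) (Fin.snoc (α := fun _ => Ω × M) h (w, m)) ≤ D n h w := by
        refine le_of_le_of_eq ?_ (hVs n h w)
        exact Finset.single_le_sum
          (f := fun m => V (n + 1) (Fin.snoc (α := fun _ => Ω × M) h (w, m)))
          (fun _ _ => hV _ _) (Finset.mem_univ m)
      rw [hD, zero_mul]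
      exact (le_antisymm (hle.trans hD.le) (hV _ _)).symm
    · have : σ n h w m =
          V (n + 1) (Fin.snoc (α := fun _ => Ω × M) h (w, m)) / D n h w := by
        simp only [σ, dif_neg hD]
        rfl
      rw [this, mul_div_cancel₀ _ hD]
  refine ⟨σ, fun n => ?_⟩
  induction n with
  | zero => intro h; rw [hV0]; rfl
  | succ n ih =>
    intro h
    induction h using Fin.snocCases with
    | _ h x =>
      rw [pathLaw_snoc, ih, ← hσ]
      simp only [senderStep, D]
      ring

/-- The step of the coupled chain on pairs of a true and a fictitious state: both stay put with
probability `l`, and otherwise both are redrawn, jointly from `c`. -/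
def coupledStep [DecidableEq Ω] (c : stdSimplex ℝ (Ω × Ω)) (l : ℝ) :
    ∀ n : ℕ, (Fin n → Ω × Ω) → Ω × Ω → ℝ
  | 0, _, x => c x
  | n + 1, h, x => (if h (Fin.last n) = x then l else 0) + (1 - l) * c x

lemma coupledStep_succ [DecidableEq Ω] (c : stdSimplex ℝ (Ω × Ω)) (l : ℝ) (n : ℕ)
    (h : Fin (n + 1) → Ω × Ω) (x : Ω × Ω) :
    coupledStep c l (n + 1) h x = (if h (Fin.last n) = x then l else 0) + (1 - l) * c x := rfl

lemma coupledStep_nonneg [DecidableEq Ω] (c : stdSimplex ℝ (Ω × Ω)) {l : ℝ} (hl0 : 0 ≤ l)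
    (hl1 : l ≤ 1) : ∀ (n : ℕ) (h : Fin n → Ω × Ω) (x : Ω × Ω), 0 ≤ coupledStep c l n h x
  | 0, _, x => stdSimplex.zero_le c x
  | n + 1, h, x => by
    refine add_nonneg (by split_ifs <;> simp [hl0])
      (mul_nonneg (sub_nonneg.2 hl1) (stdSimplex.zero_le c x))

/-- Given the past of both chains, the true state moves according to `Q`. -/
lemma sum_coupledStep [DecidableEq Ω] {μ : stdSimplex ℝ Ω} {Q : Ω → stdSimplex ℝ Ω}
    {c : stdSimplex ℝ (Ω × Ω)} (hc : c ∈ copulas μ) {l : ℝ}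
    (hQ : ∀ w w', Q w w' = (if w = w' then l else 0) + (1 - l) * μ w') (w : Ω) :
    ∀ (n : ℕ) (h : Fin n → Ω × Ω),
      ∑ w', coupledStep c l n h (w, w') = stateStep μ Q n (fun i => (h i).1) w
  | 0, _ => hc.1 w
  | n + 1, h => by
    simp only [coupledStep, stateStep_succ, hQ, Finset.sum_add_distrib, ← Finset.mul_sum, hc.1 w]
    congr 1
    obtain ⟨x, y⟩ := h (Fin.last n)
    by_cases hx : x = w <;> simp [hx]

/-- Along the coupled chain, the law of the current true state given the fictitious states up to
now depends on the current fictitious state `w'` only, and it is `c(· | w')`; and the fictitious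
states follow the chain `Q`. -/
lemma sum_pathLaw_coupledStep [DecidableEq Ω] {μ : stdSimplex ℝ Ω} {Q : Ω → stdSimplex ℝ Ω}
    {c : stdSimplex ℝ (Ω × Ω)} (hc : c ∈ copulas μ) (hμ : ∀ w, 0 < μ w) {l : ℝ}
    (hQ : ∀ w w', Q w w' = (if w = w' then l else 0) + (1 - l) * μ w') (n : ℕ)
    (v' : Fin n → Ω) (w w' : Ω) :
    ∑ v : Fin n → Ω, pathLaw (coupledStep c l) n (fun i => (v i, v' i)) *
        coupledStep c l n (fun i => (v i, v' i)) (w, w') =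
      c (w, w') / μ w' *
        (pathLaw (fun n h x => stateStep μ Q n h x) n v' * stateStep μ Q n v' w') := by
  induction n generalizing w w' with
  | zero => simp [pathLaw, coupledStep, stateStep, (hμ w').ne']
  | succ n ih =>
    induction v' using Fin.snocCases with
    | _ v' y =>
      have hy : ∑ x, c (x, y) / μ y = 1 := by
        rw [← Finset.sum_div, hc.2 y, div_self (hμ y).ne']
      rw [sum_path_succ, Finset.sum_comm]
      simp only [pathLaw, coupledStep_succ, Fin.snoc_castSucc, Fin.snoc_last, stateStep_succ,
        ← Finset.sum_mul, ih]
      set P := pathLaw (fun n h x => stateStep μ Q n h x) n v' * stateStep μ Q n v' y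
      have h1 : ∑ x, c (x, y) / μ y * P *
          ((if (x, y) = (w, w') then l else 0) + (1 - l) * c (w, w')) =
          P * (∑ x, c (x, y) / μ y * (if (x, y) = (w, w') then l else 0)) +
            P * ((1 - l) * c (w, w')) * ∑ x, c (x, y) / μ y := by
        rw [Finset.mul_sum, Finset.mul_sum, ← Finset.sum_add_distrib]
        exact Finset.sum_congr rfl fun x _ => by ring
      rw [h1, hy, hQ]
      have hw' := (hμ w').ne'
      by_cases hyw : y = w'
      · subst hyw
        simp only [Prod.mk.injEq, and_true, mul_ite, mul_zero, Finset.sum_ite_eq',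
          Finset.mem_univ, if_true]
        field_simp
      · simp only [Prod.mk.injEq, hyw, and_false, if_false, mul_zero, Finset.sum_const_zero]
        field_simp
        ring

/-- The sender can play as if the states were fictitious states that follow the same chain and are
coupled to the true ones through the copula `c`. The fictitious states cannot be stored in the
history; the behavior strategy comes from `exists_sender_strategy`. -/
lemma exists_sender_deviation [DecidableEq Ω] {μ : stdSimplex ℝ Ω} {Q : Ω → stdSimplex ℝ Ω}
    {c : stdSimplex ℝ (Ω × Ω)} (hc : c ∈ copulas μ) (hμ : ∀ w, 0 < μ w) {l : ℝ} (hl0 : 0 ≤ l)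
    (hl1 : l ≤ 1) (hQ : ∀ w w', Q w w' = (if w = w' then l else 0) + (1 - l) * μ w')
    (σ : SenderStrategy Ω M) :
    ∃ σ' : SenderStrategy Ω M, ∀ (τ : ReceiverStrategy M A) (n : ℕ) (w : Ω) (a : A),
      periodLaw μ Q σ' τ n w a = ∑ w', c (w, w') / μ w' * periodLaw μ Q σ τ n w' a := by
  -- The joint weights of true states and messages; `v` runs through the fictitious states.
  let V : ∀ n : ℕ, (Fin n → Ω × M) → ℝ := fun n h =>
    ∑ v : Fin n → Ω, pathLaw (coupledStep c l) n (fun i => ((h i).1, v i)) *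
      pathLaw (messageStep σ) n (fun i => (v i, (h i).2))
  have hVsnoc : ∀ n h w m, V (n + 1) (Fin.snoc (α := fun _ => Ω × M) h (w, m)) =
      ∑ v : Fin n → Ω, ∑ w', pathLaw (coupledStep c l) n (fun i => ((h i).1, v i)) *
        coupledStep c l n (fun i => ((h i).1, v i)) (w, w') *
        (pathLaw (messageStep σ) n (fun i => (v i, (h i).2)) *
          σ n (fun i => (v i, (h i).2)) w' m) := by
    intro n h w m
    simp only [V]
    rw [sum_path_succ]
    simp only [pathLaw, Fin.snoc_castSucc, Fin.snoc_last, messageStep]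
  obtain ⟨σ', hσ'⟩ := exists_sender_strategy μ Q σ V (fun h => by simp [V, pathLaw])
    (fun n h => Finset.sum_nonneg fun v _ => mul_nonneg
      (pathLaw_nonneg _ (coupledStep_nonneg c hl0 hl1) _ _) (pathLaw_messageStep_nonneg _ _ _))
    (fun n h w => by
      simp only [hVsnoc]
      simp only [V, Finset.sum_mul]
      rw [Finset.sum_comm]
      refine Finset.sum_congr rfl fun v _ => ?_
      rw [Finset.sum_comm]
      simp only [← Finset.mul_sum, stdSimplex.sum_eq_one, mul_one, ← Finset.sum_mul]
      rw [sum_coupledStep hc hQ]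
      ring)
  have hsig : ∀ n w m m', signalLaw μ Q σ' n w m m' =
      ∑ w', c (w, w') / μ w' * signalLaw μ Q σ n w' m m' := by
    intro n w m m'
    have h1 : signalLaw μ Q σ' n w m m' =
        ∑ v : Fin n → Ω, V (n + 1) (Fin.snoc (α := fun _ => Ω × M) (fun i => (v i, m i)) (w, m')) :=
      Finset.sum_congr rfl fun v _ => by rw [← pathLaw_snoc, hσ']
    rw [h1]
    simp only [hVsnoc]
    simp only [signalLaw]
    simp only [pathLaw_senderStep, senderStep]
    simp_rw [Finset.sum_comm (s := (Finset.univ : Finset (Fin n → Ω)))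
      (t := (Finset.univ : Finset Ω))]
    refine Finset.sum_congr rfl fun w' _ => ?_
    rw [Finset.sum_comm, Finset.mul_sum]
    refine Finset.sum_congr rfl fun v' _ => ?_
    rw [← Finset.sum_mul, sum_pathLaw_coupledStep hc hμ hQ]
    ring
  refine ⟨σ', fun τ n w a => ?_⟩
  simp only [periodLaw, hsig, Finset.mul_sum, Finset.sum_mul]
  rw [Finset.sum_comm (γ := Ω)]
  refine Finset.sum_congr rfl fun m _ => ?_
  rw [Finset.sum_comm (γ := Ω)]
  refine Finset.sum_congr rfl fun m' _ => Finset.sum_congr rfl fun w' _ => ?_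
  ring

/-! ### Pseudo-renewal chains -/

/-- The invariant distribution of an irreducible chain has full support. -/
lemma invariant_pos [DecidableEq Ω] {Q : Ω → stdSimplex ℝ Ω} {μ : stdSimplex ℝ Ω}
    (hirr : (transitionMatrix Q).IsIrreducible) (hμ : IsInvariant Q μ) (w : Ω) : 0 < μ w := by
  have hpow : ∀ (k : ℕ) (w : Ω), ∑ v, μ v * (transitionMatrix Q ^ k) v w = μ w := by
    intro k
    induction k with
    | zero => intro w; simp [Matrix.one_apply]
    | succ k ih =>
      intro w
      simp only [pow_succ, Matrix.mul_apply, Finset.mul_sum]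
      rw [Finset.sum_comm]
      simp only [← mul_assoc, ← Finset.sum_mul, ih]
      exact hμ w
  obtain ⟨v, hv⟩ : ∃ v, 0 < μ v := by
    by_contra! h
    have := Finset.sum_nonpos fun v (_ : v ∈ Finset.univ) => h v
    rw [stdSimplex.sum_eq_one] at this
    linarith
  have hQ0 : ∀ i j, 0 ≤ transitionMatrix Q i j := fun i j => stdSimplex.zero_le (Q i) j
  obtain ⟨k, -, hk⟩ := (Matrix.isIrreducible_iff_exists_pow_pos hQ0).1 hirr v w
  rw [← hpow k w]
  exact (mul_pos hv hk).trans_le (Finset.single_le_sum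
    (f := fun v => μ v * (transitionMatrix Q ^ k) v w)
    (fun i _ => mul_nonneg (stdSimplex.zero_le μ i) (Matrix.pow_apply_nonneg hQ0 k i w))
    (Finset.mem_univ v))

/-- A pseudo-renewal chain with invariant distribution `μ` stays put with some probability `l`,
and otherwise it redraws the state from `μ`. -/
lemma IsPseudoRenewal.exists_lazy [DecidableEq Ω] {Q : Ω → stdSimplex ℝ Ω}
    {μ : stdSimplex ℝ Ω} (hpr : IsPseudoRenewal Q) (hμ : IsInvariant Q μ) :
    ∃ l : ℝ, 0 ≤ l ∧ l ≤ 1 ∧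
      ∀ w w', Q w w' = (if w = w' then l else 0) + (1 - l) * μ w' := by
  obtain ⟨β, hβ0, hβ1, hβ⟩ := hpr
  have hQ : ∀ w w', Q w w' = (if w = w' then 1 - ∑ x, β x else 0) + β w' := by
    intro w w'
    by_cases hw : w = w'
    · subst hw
      have h1 := stdSimplex.sum_eq_one (Q w)
      rw [← Finset.add_sum_erase _ _ (Finset.mem_univ w)] at h1 ⊢
      rw [Finset.sum_congr rfl fun x hx => hβ x w (Finset.ne_of_mem_erase hx)] at h1
      simp only [if_true]
      linarith
    · simp [hw, hβ w' w (Ne.symm hw)]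
  have hμβ : ∀ w, (∑ x, β x) * μ w = β w := by
    intro w
    have h := hμ w
    simp only [hQ, mul_add, mul_ite, mul_zero, Finset.sum_add_distrib, Finset.sum_ite_eq',
      Finset.mem_univ, if_true, ← Finset.sum_mul, stdSimplex.sum_eq_one] at h
    linarith
  refine ⟨1 - ∑ x, β x, by linarith, by linarith [Finset.sum_nonneg fun x (_ : x ∈ Finset.univ) => hβ0 x], ?_⟩
  intro w w'
  rw [hQ, sub_sub_cancel, hμβ]

end Sender

/-! ### Discounted averages -/

/-- The `δ`-discounted average of a sequence. -/
def discountedMean (δ : ℝ) (f : ℕ → ℝ) : ℝ := (1 - δ) * ∑' n, δ ^ n * f n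

lemma summable_discounted {δ : ℝ} (h0 : 0 ≤ δ) (h1 : δ < 1) {f : ℕ → ℝ} {C : ℝ}
    (hf : ∀ n, |f n| ≤ C) : Summable fun n => δ ^ n * f n := by
  refine Summable.of_norm_bounded ((summable_geometric_of_lt_one h0 h1).mul_right C) fun n => ?_
  rw [norm_mul, norm_pow, Real.norm_of_nonneg h0, Real.norm_eq_abs]
  exact mul_le_mul_of_nonneg_left (hf n) (pow_nonneg h0 n)

lemma discountedMean_sum {ι : Type*} [Fintype ι] {δ : ℝ} (h0 : 0 ≤ δ) (h1 : δ < 1)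
    {f : ι → ℕ → ℝ} (hf : ∀ i n, |f i n| ≤ 1) (k : ι → ℝ) :
    discountedMean δ (fun n => ∑ i, k i * f i n) = ∑ i, k i * discountedMean δ (f i) := by
  have h : ∀ n, δ ^ n * ∑ i, k i * f i n = ∑ i, k i * (δ ^ n * f i n) := fun n => by
    rw [Finset.mul_sum]
    exact Finset.sum_congr rfl fun i _ => by ring
  simp only [discountedMean, h]
  rw [Summable.tsum_finsetSum fun i _ => (summable_discounted h0 h1 (hf i)).mul_left (k i),
    Finset.mul_sum]
  refine Finset.sum_congr rfl fun i _ => ?_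
  rw [tsum_mul_left]
  ring

lemma discountedMean_const {δ : ℝ} (h0 : 0 ≤ δ) (h1 : δ < 1) (x : ℝ) :
    discountedMean δ (fun _ => x) = x := by
  rw [discountedMean, tsum_mul_right, tsum_geometric_of_lt_one h0 h1, ← mul_assoc,
    mul_inv_cancel₀ (sub_pos.2 h1).ne', one_mul]

lemma discountedMean_nonneg {δ : ℝ} (h0 : 0 ≤ δ) (h1 : δ < 1) {f : ℕ → ℝ} (hf : ∀ n, 0 ≤ f n) :
    0 ≤ discountedMean δ f :=
  mul_nonneg (sub_nonneg.2 h1.le) (tsum_nonneg fun n => mul_nonneg (pow_nonneg h0 n) (hf n))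

section Discounted

variable {Ω M A : Type*} [Fintype Ω] [Fintype M] [Fintype A]

lemma abs_periodLaw_le {μ : stdSimplex ℝ Ω} {Q : Ω → stdSimplex ℝ Ω} (hμ : IsInvariant Q μ)
    (σ : SenderStrategy Ω M) (τ : ReceiverStrategy M A) (w : Ω) (a : A) (n : ℕ) :
    |periodLaw μ Q σ τ n w a| ≤ 1 := by
  rw [abs_of_nonneg (periodLaw_nonneg _ _ _ _ _ _ _)]
  calc periodLaw μ Q σ τ n w a ≤ ∑ a, periodLaw μ Q σ τ n w a :=
        Finset.single_le_sum (f := fun a => periodLaw μ Q σ τ n w a)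
          (fun _ _ => periodLaw_nonneg _ _ _ _ _ _ _) (Finset.mem_univ a)
    _ = μ w := sum_periodLaw hμ σ τ n w
    _ ≤ 1 := stdSimplex.le_one μ w

lemma sum_discountedMean_periodLaw {μ : stdSimplex ℝ Ω} {Q : Ω → stdSimplex ℝ Ω}
    (hμ : IsInvariant Q μ) (σ : SenderStrategy Ω M) (τ : ReceiverStrategy M A) {δ : ℝ}
    (h0 : 0 ≤ δ) (h1 : δ < 1) (w : Ω) :
    ∑ a, discountedMean δ (fun n => periodLaw μ Q σ τ n w a) = μ w := by
  have h := discountedMean_sum h0 h1 (fun a n => abs_periodLaw_le hμ σ τ w a n) fun _ => 1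
  simp only [one_mul, sum_periodLaw hμ, discountedMean_const h0 h1] at h
  exact h.symm

/-- The discounted average of the laws of the state and the action in the periods `0, 1, …`. -/
def discountedOutcome {μ : stdSimplex ℝ Ω} {Q : Ω → stdSimplex ℝ Ω} (hμ : IsInvariant Q μ)
    (σ : SenderStrategy Ω M) (τ : ReceiverStrategy M A) {δ : ℝ} (h0 : 0 ≤ δ) (h1 : δ < 1) :
    stdSimplex ℝ (Ω × A) :=
  ⟨fun x => discountedMean δ fun n => periodLaw μ Q σ τ n x.1 x.2,
    fun _ => discountedMean_nonneg h0 h1 fun _ => periodLaw_nonneg _ _ _ _ _ _ _, by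
    rw [Fintype.sum_prod_type]
    simp only [sum_discountedMean_periodLaw hμ σ τ h0 h1, stdSimplex.sum_eq_one]⟩

lemma discountedOutcome_apply {μ : stdSimplex ℝ Ω} {Q : Ω → stdSimplex ℝ Ω}
    (hμ : IsInvariant Q μ) (σ : SenderStrategy Ω M) (τ : ReceiverStrategy M A) {δ : ℝ}
    (h0 : 0 ≤ δ) (h1 : δ < 1) (w : Ω) (a : A) :
    discountedOutcome hμ σ τ h0 h1 (w, a) =
      discountedMean δ fun n => periodLaw μ Q σ τ n w a := rfl

lemma stateMarginal_discountedOutcome {μ : stdSimplex ℝ Ω} {Q : Ω → stdSimplex ℝ Ω}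
    (hμ : IsInvariant Q μ) (σ : SenderStrategy Ω M) (τ : ReceiverStrategy M A) {δ : ℝ}
    (h0 : 0 ≤ δ) (h1 : δ < 1) (w : Ω) :
    stateMarginal (discountedOutcome hμ σ τ h0 h1) w = μ w :=
  sum_discountedMean_periodLaw hμ σ τ h0 h1 w

lemma discountedPayoff_eq {μ : stdSimplex ℝ Ω} {Q : Ω → stdSimplex ℝ Ω} (hμ : IsInvariant Q μ)
    (σ : SenderStrategy Ω M) (τ : ReceiverStrategy M A) {δ : ℝ} (h0 : 0 ≤ δ) (h1 : δ < 1)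
    (u : Ω → A → ℝ) :
    discountedPayoff μ Q u δ σ τ = outcomePayoff (discountedOutcome hμ σ τ h0 h1) u := by
  set C : ℝ := ∑ w, ∑ a, |u w a|
  have hC : ∀ w a, |u w a| ≤ C := fun w a =>
    (Finset.single_le_sum (f := fun a => |u w a|) (fun _ _ => abs_nonneg _)
      (Finset.mem_univ a)).trans
      (Finset.single_le_sum (f := fun w => ∑ a, |u w a|)
        (fun _ _ => Finset.sum_nonneg fun _ _ => abs_nonneg _) (Finset.mem_univ w))
  let g : ℕ → (ℕ → Stage Ω M A) → ℝ := fun n x => u (x n).state (x n).action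
  have hg : ∀ n, Measurable (g n) := fun n =>
    (Measurable.of_discrete (f := fun y : Stage Ω M A => u y.state y.action)).comp
      (measurable_pi_apply n)
  have hint : ∀ n, Integrable (fun x => δ ^ n * g n x) (playLaw μ Q σ τ) := fun n =>
    ((integrable_const C).mono' (hg n).aestronglyMeasurable
      (Filter.Eventually.of_forall fun x => hC _ _)).const_mul _
  have hnorm : Summable fun n => ∫ x, ‖δ ^ n * g n x‖ ∂playLaw μ Q σ τ := by
    refine Summable.of_nonneg_of_le (fun n => integral_nonneg fun x => norm_nonneg _)
      (fun n => ?_) ((summable_geometric_of_lt_one h0 h1).mul_right C)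
    calc ∫ x, ‖δ ^ n * g n x‖ ∂playLaw μ Q σ τ ≤ ∫ x, δ ^ n * C ∂playLaw μ Q σ τ := by
          refine integral_mono (hint n).norm (integrable_const _) fun x => ?_
          change ‖δ ^ n * g n x‖ ≤ δ ^ n * C
          rw [norm_mul, norm_pow, Real.norm_of_nonneg h0]
          exact mul_le_mul_of_nonneg_left (hC _ _) (pow_nonneg h0 n)
      _ = δ ^ n * C := by simp
  have h2 : discountedPayoff μ Q u δ σ τ =
      discountedMean δ fun n => ∑ w, ∑ a, periodLaw μ Q σ τ n w a * u w a := by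
    rw [discountedPayoff, integral_const_mul, discountedMean]
    congr 1
    rw [← integral_tsum_of_summable_integral_norm hint hnorm]
    refine tsum_congr fun n => ?_
    rw [integral_const_mul, integral_period]
  rw [h2, outcomePayoff]
  have h3 := discountedMean_sum h0 h1
    (f := fun (x : Ω × A) n => periodLaw μ Q σ τ n x.1 x.2)
    (fun x n => abs_periodLaw_le hμ σ τ x.1 x.2 n) (fun x => u x.1 x.2)
  simp only [Fintype.sum_prod_type] at h3
  simp only [discountedOutcome_apply, mul_comm _ (u _ _)]
  exact h3

/-! ### Approximate equilibria -/

/-- An `ε`-equilibrium for a single discount factor already gives an outcome that satisfies all the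
requirements up to `ε`. -/
lemma exists_approximate_outcome [DecidableEq Ω] [DecidableEq A] {Q : Ω → stdSimplex ℝ Ω}
    {μ : stdSimplex ℝ Ω} (hirr : (transitionMatrix Q).IsIrreducible) (hpr : IsPseudoRenewal Q)
    (hμ : IsInvariant Q μ) {uS uR : Ω → A → ℝ} {e : ℝ × ℝ}
    (he : IsUniformEquilibriumPayoff M μ Q uS uR e) {ε : ℝ} (hε : 0 < ε) :
    ∃ ν : stdSimplex ℝ (Ω × A), (∀ w, stateMarginal ν w = μ w) ∧
      |outcomePayoff ν uS - e.1| ≤ ε ∧ |outcomePayoff ν uR - e.2| ≤ ε ∧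
      (∀ a a', ∑ w, ν (w, a) * (uR w a' - uR w a) ≤ ε) ∧
      ∀ c ∈ copulas μ, ∑ w, ∑ a, (∑ w', c (w, w') / μ w' * ν (w', a)) * uS w a -
        outcomePayoff ν uS ≤ ε := by
  -- The smallest admissible discount factor will do.
  obtain ⟨δ, hδ0, h1, σ, τ, h⟩ := he ε hε
  have h0 := hδ0.le
  obtain ⟨hS, hR, hnorm⟩ := h δ le_rfl h1
  simp only [discountedPayoff_eq hμ _ _ h0 h1] at hS hR hnorm
  have hn := norm_prod_le_iff.1 hnorm
  refine ⟨discountedOutcome hμ σ τ h0 h1, stateMarginal_discountedOutcome hμ σ τ h0 h1,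
    hn.1, hn.2, fun a a' => ?_, fun c hc => ?_⟩
  · let f : A → A := fun b => if b = a then a' else b
    obtain ⟨τ', hτ'⟩ := exists_receiver_deviation μ Q τ f
    have hν : ∀ w b, discountedOutcome hμ σ τ' h0 h1 (w, b) =
        ∑ d, (if f d = b then 1 else 0) * discountedOutcome hμ σ τ h0 h1 (w, d) := by
      intro w b
      simp only [discountedOutcome_apply, hτ' σ]
      exact discountedMean_sum h0 h1 (fun d n => abs_periodLaw_le hμ σ τ w d n) _
    have hdev : outcomePayoff (discountedOutcome hμ σ τ' h0 h1) uR -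
        outcomePayoff (discountedOutcome hμ σ τ h0 h1) uR =
        ∑ w, discountedOutcome hμ σ τ h0 h1 (w, a) * (uR w a' - uR w a) := by
      simp only [outcomePayoff]
      rw [← Finset.sum_sub_distrib]
      refine Finset.sum_congr rfl fun w _ => ?_
      have h2 : ∑ b, discountedOutcome hμ σ τ' h0 h1 (w, b) * uR w b =
          ∑ d, discountedOutcome hμ σ τ h0 h1 (w, d) * uR w (f d) := by
        simp only [hν, Finset.sum_mul]
        rw [Finset.sum_comm]
        refine Finset.sum_congr rfl fun d _ => ?_
        simp
      rw [h2, ← Finset.sum_sub_distrib, Finset.sum_eq_single a]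
      · simp only [f, if_true]
        ring
      · intro b _ hb
        simp [f, hb]
      · simp
    rw [← hdev]
    linarith [hR τ']
  · obtain ⟨l, hl0, hl1, hQ⟩ := hpr.exists_lazy hμ
    obtain ⟨σ', hσ'⟩ := exists_sender_deviation (A := A) hc (invariant_pos hirr hμ) hl0 hl1 hQ σ
    have hν : ∀ w a, discountedOutcome hμ σ' τ h0 h1 (w, a) =
        ∑ w', c (w, w') / μ w' * discountedOutcome hμ σ τ h0 h1 (w', a) := by
      intro w a
      simp only [discountedOutcome_apply, hσ' τ]
      exact discountedMean_sum h0 h1 (fun w' n => abs_periodLaw_le hμ σ τ w' a n) _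
    have h2 := hS σ'
    simp only [← hν]
    simp only [outcomePayoff] at h2 ⊢
    linarith

/-- Compactness for approximate solutions: a limit point of `x ε`, as `ε → 0`, satisfies exactly
every closed condition `F ≤ 0` that each `x ε` satisfies up to `ε`. -/
lemma exists_limit_point {X : Type*} [TopologicalSpace X] [FirstCountableTopology X]
    [CompactSpace X] (x : ℝ → X) :
    ∃ y, ∀ F : X → ℝ, Continuous F → (∀ ε, 0 < ε → F (x ε) ≤ ε) → F y ≤ 0 := by
  obtain ⟨y, φ, hφ, hy⟩ := CompactSpace.tendsto_subseq fun n : ℕ => x (1 / ((n : ℝ) + 1))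
  refine ⟨y, fun F hF h => ?_⟩
  refine le_of_tendsto_of_tendsto' ((hF.tendsto y).comp hy)
    (tendsto_one_div_add_atTop_nhds_zero_nat.comp hφ.tendsto_atTop) fun n => ?_
  exact h _ Nat.one_div_pos_of_nat

/-- An obedient outcome with a prior of full support is a Bayes correlated equilibrium: the
decision rule is its conditional law of the action given the state. -/
lemma IsObedient.isBayesCorrelatedEquilibrium {μ : stdSimplex ℝ Ω} (hμ : ∀ w, 0 < μ w)
    {uR : Ω → A → ℝ} {ν : stdSimplex ℝ (Ω × A)} (hν : ∀ w, stateMarginal ν w = μ w)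
    (hob : IsObedient uR ν) : IsBayesCorrelatedEquilibrium μ uR ν := by
  refine ⟨fun w => ⟨fun a => ν (w, a) / μ w,
    fun a => div_nonneg (stdSimplex.zero_le _ _) (hμ w).le, ?_⟩, ?_, ?_⟩
  · rw [← Finset.sum_div]
    exact (div_eq_one_iff_eq (hμ w).ne').2 (hν w)
  · intro w a
    exact (mul_div_cancel₀ _ (hμ w).ne').symm
  · intro a a'
    have h : ∀ w, μ w * (ν (w, a) / μ w) = ν (w, a) := fun w => mul_div_cancel₀ _ (hμ w).ne'
    have h2 := hob a a'
    simp only [mul_sub, Finset.sum_sub_distrib] at h2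
    change ∑ w, μ w * (ν (w, a) / μ w) * uR w a' ≤ ∑ w, μ w * (ν (w, a) / μ w) * uR w a
    simp only [h]
    linarith

end Discounted

end DynamicPersuasion

end

theorem proposition1 {Ω M A : Type*} [Fintype Ω] [DecidableEq Ω] [Fintype M] [Fintype A]
    (hM : min (Fintype.card Ω) (Fintype.card A) ≤ Fintype.card M)
    (Q : Ω → stdSimplex ℝ Ω) (μ : stdSimplex ℝ Ω)
    (hirr : (DynamicPersuasion.transitionMatrix Q).IsIrreducible)
    (haper : DynamicPersuasion.IsAperiodic Q)
    (hpr : DynamicPersuasion.IsPseudoRenewal Q)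
    (hμ : DynamicPersuasion.IsInvariant Q μ)
    (uS uR : Ω → A → ℝ) (e : ℝ × ℝ)
    (he : DynamicPersuasion.IsUniformEquilibriumPayoff M μ Q uS uR e) :
    (∃ ν : stdSimplex ℝ (Ω × A),
      (∀ w, DynamicPersuasion.stateMarginal ν w = μ w) ∧
      e = (DynamicPersuasion.outcomePayoff ν uS, DynamicPersuasion.outcomePayoff ν uR) ∧
      DynamicPersuasion.IsObedient uR ν ∧
      DynamicPersuasion.IsRobustToCopulaDeviations uS ν) ∧
    (∀ ν : stdSimplex ℝ (Ω × A),
      (∀ w, DynamicPersuasion.stateMarginal ν w = μ w) →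
      e = (DynamicPersuasion.outcomePayoff ν uS, DynamicPersuasion.outcomePayoff ν uR) →
      DynamicPersuasion.IsObedient uR ν →
      DynamicPersuasion.IsRobustToCopulaDeviations uS ν →
      DynamicPersuasion.IsBayesCorrelatedEquilibrium μ uR ν) := by
  classical
  refine ⟨?_, fun ν hν _ hob _ =>
    hob.isBayesCorrelatedEquilibrium (DynamicPersuasion.invariant_pos hirr hμ) hν⟩
  -- `ν₁` is a default value where `ε ≤ 0`.
  obtain ⟨ν₁, -⟩ := DynamicPersuasion.exists_approximate_outcome hirr hpr hμ he one_pos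
  have happ : ∀ ε : ℝ, ∃ ν : stdSimplex ℝ (Ω × A), 0 < ε →
      (∀ w, DynamicPersuasion.stateMarginal ν w = μ w) ∧
      |DynamicPersuasion.outcomePayoff ν uS - e.1| ≤ ε ∧
      |DynamicPersuasion.outcomePayoff ν uR - e.2| ≤ ε ∧
      (∀ a a', ∑ w, ν (w, a) * (uR w a' - uR w a) ≤ ε) ∧
      ∀ c ∈ DynamicPersuasion.copulas μ,
        ∑ w, ∑ a, (∑ w', c (w, w') / μ w' * ν (w', a)) * uS w a -
          DynamicPersuasion.outcomePayoff ν uS ≤ ε := fun ε => by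
    by_cases hε : 0 < ε
    · obtain ⟨ν, h⟩ := DynamicPersuasion.exists_approximate_outcome hirr hpr hμ he hε
      exact ⟨ν, fun _ => h⟩
    · exact ⟨ν₁, fun h => absurd h hε⟩
  choose N hN using happ
  obtain ⟨ν, hlim⟩ := DynamicPersuasion.exists_limit_point N
  have hcoe : ∀ x : Ω × A, Continuous fun ν : stdSimplex ℝ (Ω × A) => ν x := fun x =>
    (continuous_apply x).comp continuous_subtype_val
  have hpay : ∀ u : Ω → A → ℝ,
      Continuous fun ν : stdSimplex ℝ (Ω × A) => DynamicPersuasion.outcomePayoff ν u := fun u =>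
    continuous_finsetSum _ fun w _ => continuous_finsetSum _ fun a _ =>
      (hcoe (w, a)).mul continuous_const
  have hmarg : ∀ w, DynamicPersuasion.stateMarginal ν w = μ w := fun w => by
    refine sub_eq_zero.1 (abs_nonpos_iff.1
      (hlim (fun ν => |DynamicPersuasion.stateMarginal ν w - μ w|) ?_ ?_))
    · exact ((continuous_finsetSum _ fun a _ => hcoe (w, a)).sub continuous_const).abs
    · intro ε hε
      simp [(hN ε hε).1 w, hε.le]
  refine ⟨ν, hmarg, ?_, fun a a' => ?_, ?_⟩
  · refine Prod.ext (Eq.symm ?_) (Eq.symm ?_)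
    · exact sub_eq_zero.1 (abs_nonpos_iff.1
        (hlim (fun ν => |DynamicPersuasion.outcomePayoff ν uS - e.1|)
          ((hpay uS).sub continuous_const).abs fun ε hε => (hN ε hε).2.1))
    · exact sub_eq_zero.1 (abs_nonpos_iff.1
        (hlim (fun ν => |DynamicPersuasion.outcomePayoff ν uR - e.2|)
          ((hpay uR).sub continuous_const).abs fun ε hε => (hN ε hε).2.2.1))
  · have h := hlim (fun ν => ∑ w, ν (w, a) * (uR w a' - uR w a))
      (continuous_finsetSum _ fun w _ => (hcoe (w, a)).mul continuous_const)
      fun ε hε => (hN ε hε).2.2.2.1 a a'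
    have h2 : ∑ w, ν (w, a) * (uR w a - uR w a') = -∑ w, ν (w, a) * (uR w a' - uR w a) := by
      rw [← Finset.sum_neg_distrib]
      exact Finset.sum_congr rfl fun w _ => by ring
    rw [h2]
    exact neg_nonneg.2 h
  · rintro ν' ⟨c, hc, hν'⟩
    have hst : DynamicPersuasion.stateMarginal ν = μ := funext hmarg
    rw [hst] at hc hν'
    have h := hlim (fun ν => ∑ w, ∑ a, (∑ w', c (w, w') / μ w' * ν (w', a)) * uS w a -
        DynamicPersuasion.outcomePayoff ν uS)
      ((continuous_finsetSum _ fun w _ => continuous_finsetSum _ fun a _ =>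
        (continuous_finsetSum _ fun w' _ => continuous_const.mul (hcoe (w', a))).mul
          continuous_const).sub (hpay uS))
      fun ε hε => (hN ε hε).2.2.2.2 c hc
    simp only [← hν'] at h
    exact sub_nonpos.1 h
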